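/- Let $m$ be a positive integer, $q=2^m$, and let $F=\mathbb{F}_q$ be the finite field with $q$ elements, $F^*=F\setminus\{0\}$, with trace function $\mathrm{Tr}\colon F\to\mathbb{F}_2$. For $a\in F$ let $$K(a)=\sum_{x\in F^*}(-1)^{\mathrm{Tr}(ax+1/x)}$$ be the Kloosterman sum. For $c\in F$ let $\sqrt{c}$ denote the unique element of $F$ whose square is $c$. Let $b,c\in F$, $k_1=b^2+c+1$ and $k_2=b^2+b+c+\sqrt{c}$. If $k_1k_2\neq 0$, then $$K(k_1k_2)=K(k_1k_2+k_2).$$ -/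

import Mathlib

noncomputable section

/-- The Kloosterman sum `K(a) = ∑_{x ∈ F*} (-1)^{Tr(a x + 1/x)}` over a finite field `F` of
characteristic two, where `Tr` is the absolute trace from `F` to `𝔽₂`. -/
def kloostermanSum {F : Type*} [Field F] [Fintype F] [DecidableEq F] [Algebra (ZMod 2) F]
    (a : F) : ℤ :=
  ∑ x ∈ Finset.univ.filter (fun x : F => x ≠ 0),
    (-1 : ℤ) ^ (Algebra.trace (ZMod 2) F (a * x + 1 / x)).val

/-- The unique square root of an element of a finite field of characteristic two: the inverse of
the Frobenius automorphism `x ↦ x ^ 2`. -/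
def sqrtCharTwo {F : Type*} [Field F] [Finite F] [CharP F 2] (c : F) : F :=
  (frobeniusEquiv F 2).symm c

/-- The defining property of the square root. -/
theorem sqrtCharTwo_sq {F : Type*} [Field F] [Finite F] [CharP F 2] (c : F) :
    sqrtCharTwo c ^ 2 = c :=
  frobenius_apply_frobeniusEquiv_symm F 2 c

end

section

variable {F : Type*} [Field F]

/-! Put b = t + √c: then k₁ = (t+1)² and k₂ = t(t+1), so the claim is K(t(t+1)³) = K(t³(t+1)). Up to
a constant, K(a) counts points on y² + xy = x³ + a, and a 3-isogeny joins the two curves. Here this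
is elementary. The map `isogenyX` preserves signs (`traceSign_isogenyX`) and omits two nonzero
abscissas, both of sign χ(t), where χ is `traceSign`. If X has N(X) ≠ 1 preimages, its sign is also
χ(t) (`traceSign_eq_of_card_ne_one`). So the sum of (N(X) − 1)(sign(X) − χ(t)) vanishes, which
equates the two sums. -/

/-- In characteristic two, if the cubic `x³ + e₁x² + e₂x + e₃` over a finite field has nonzero
discriminant and does not have exactly one root, then its quadratic resolvent has a root. -/
theorem exists_root_quadraticResolvent_of_card_roots_ne_one [Fintype F] [DecidableEq F]
    [CharP F 2] (e₁ e₂ e₃ : F) (hD : e₁ * e₂ + e₃ ≠ 0)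
    (hN : (Finset.univ.filter fun x : F => x ^ 3 + e₁ * x ^ 2 + e₂ * x + e₃ = 0).card ≠ 1) :
    ∃ θ : F, θ ^ 2 + (e₁ * e₂ + e₃) * θ + (e₁ ^ 3 * e₃ + e₂ ^ 3 + e₃ ^ 2) = 0 := by
  classical
  let L := AlgebraicClosure F
  let i : F →+* L := algebraMap F L
  have hi : Function.Injective i := i.injective
  have : CharP L 2 := charP_of_injective_ringHom hi 2
  have h2 : (2 : L) = 0 := CharTwo.two_eq_zero
  let q := Fintype.card F
  obtain ⟨n, -, hq⟩ := FiniteField.card F 2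
  have hadd (x y : L) : (x + y) ^ q = x ^ q + y ^ q := by
    simp only [q, hq]; exact add_pow_char_pow x y 2 n
  have hfix (x : F) : (i x) ^ q = i x := by rw [← map_pow, FiniteField.pow_card]
  have hmem (x : L) (hx : x ^ q = x) : ∃ y, i y = x := by
    have hsp := (FiniteField.isSplittingField_sub F F).splits
    rw [Algebra.algebraMap_self, Polynomial.map_id] at hsp
    refine hsp.mem_range_of_isRoot
      (FiniteField.X_pow_card_sub_X_ne_zero F Fintype.one_lt_card) (i := i) ?_
    simp [hx, q]
  obtain ⟨α, β, γ, h⟩ : ∃ α β γ : L, (Cubic.map i ⟨1, e₁, e₂, e₃⟩).roots = {α, β, γ} :=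
    (Cubic.splits_iff_roots_eq_three (P := ⟨1, e₁, e₂, e₃⟩) one_ne_zero).1
      (IsAlgClosed.splits _)
  have hb := Cubic.b_eq_three_roots (P := ⟨1, e₁, e₂, e₃⟩) (φ := i) one_ne_zero h
  have hc := Cubic.c_eq_three_roots (P := ⟨1, e₁, e₂, e₃⟩) (φ := i) one_ne_zero h
  have hd := Cubic.d_eq_three_roots (P := ⟨1, e₁, e₂, e₃⟩) (φ := i) one_ne_zero h
  simp only [map_one, one_mul, CharTwo.neg_eq] at hb hc hd
  have hroot (x : L) : x ^ 3 + i e₁ * x ^ 2 + i e₂ * x + i e₃ = (x + α) * (x + β) * (x + γ) := by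
    rw [hb, hc, hd]; ring
  have hz {x y : L} : x + y = 0 ↔ x = y := CharTwo.add_eq_zero
  have hroots (x : L) :
      x ^ 3 + i e₁ * x ^ 2 + i e₂ * x + i e₃ = 0 ↔ x = α ∨ x = β ∨ x = γ := by
    rw [hroot]; simp [hz, or_assoc]
  have hperm (x : L) (hx : x = α ∨ x = β ∨ x = γ) : x ^ q = α ∨ x ^ q = β ∨ x ^ q = γ := by
    rw [← hroots] at hx ⊢
    have := congrArg (· ^ q) hx
    simp only [hadd, mul_pow, hfix] at this
    rw [zero_pow Fintype.card_ne_zero] at this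
    rw [← this]; ring
  have hinj {x y : L} (hxy : x ^ q = y ^ q) : x = y := by
    have : (x + y) ^ q = 0 := by rw [hadd, hxy]; exact hz.2 rfl
    exact hz.1 (eq_zero_of_pow_eq_zero this)
  have hdisc : (α + β) * (β + γ) * (γ + α) ≠ 0 := by
    intro h0
    apply hD; apply hi
    rw [map_add, map_mul, hb, hc, hd, map_zero]
    linear_combination h0 + α * β * γ * h2
  have hαβ : α ≠ β := fun e => hdisc (by rw [hz.2 e]; ring)
  have hβγ : β ≠ γ := fun e => hdisc (by rw [hz.2 e]; ring)
  have hγα : γ ≠ α := fun e => hdisc (by rw [hz.2 e]; ring)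
  have hlift (θ : L) (hθ : θ ^ q = θ)
      (hr : θ ^ 2 + (i e₁ * i e₂ + i e₃) * θ + (i e₁ ^ 3 * i e₃ + i e₂ ^ 3 + i e₃ ^ 2) = 0) :
      ∃ θ : F, θ ^ 2 + (e₁ * e₂ + e₃) * θ + (e₁ ^ 3 * e₃ + e₂ ^ 3 + e₃ ^ 2) = 0 := by
    obtain ⟨y, rfl⟩ := hmem θ hθ
    exact ⟨y, hi (by simpa using hr)⟩
  -- If Frobenius transposed two roots, the third would be the only root in F, contrary to `hN`.
  have hone (x y z : L) (hx : x ^ q = x) (hy : y ^ q = z) (hyz : y ≠ z) (hz' : z ^ q = y)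
      (hxyz : ∀ w : L, (w = α ∨ w = β ∨ w = γ) ↔ (w = x ∨ w = y ∨ w = z)) : False := by
    obtain ⟨u, rfl⟩ := hmem x hx
    apply hN
    rw [Finset.card_eq_one]
    refine ⟨u, ?_⟩
    ext w
    simp only [Finset.mem_filter, Finset.mem_univ, true_and, Finset.mem_singleton]
    rw [← hi.eq_iff, map_zero]
    simp only [map_add, map_mul, map_pow]
    rw [hroots, hxyz]
    constructor
    · rintro (hw | hw | hw)
      · exact hi hw
      · exact absurd (by rw [← hw, hfix] at hy; rw [← hw, hy]) hyz
      · exact absurd (by rw [← hw, hfix] at hz'; rw [← hw, hz']) hyz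
    · rintro rfl; exact Or.inl rfl
  -- This expression is invariant under cyclic permutations of the roots, hence under Frobenius once
  -- transpositions are excluded.
  refine hlift (α ^ 2 * β + β ^ 2 * γ + γ ^ 2 * α) ?_ ?_
  · have hθ : (α ^ 2 * β + β ^ 2 * γ + γ ^ 2 * α) ^ q =
        (α ^ q) ^ 2 * β ^ q + (β ^ q) ^ 2 * γ ^ q + (γ ^ q) ^ 2 * α ^ q := by
      simp only [hadd, mul_pow]; ring
    rw [hθ]
    rcases hperm α (by simp) with ha | ha | ha <;>
    rcases hperm β (by simp) with hb' | hb' | hb' <;>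
    rcases hperm γ (by simp) with hc' | hc' | hc' <;>
    first
    | exact absurd (hinj (ha.trans hb'.symm)) hαβ
    | exact absurd (hinj (hb'.trans hc'.symm)) hβγ
    | exact absurd (hinj (hc'.trans ha.symm)) hγα
    | (rw [ha, hb', hc']; done)
    | (rw [ha, hb', hc']; ring; done)
    | exact (hone α β γ ha hb' hβγ hc' (by intro w; tauto)).elim
    | exact (hone β γ α hb' hc' hγα ha (by intro w; tauto)).elim
    | exact (hone γ α β hc' ha hαβ hb' (by intro w; tauto)).elim
  · rw [hb, hc, hd]
    linear_combination (((α + β + γ) * (α * β + α * γ + β * γ) - α * β * γ) *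
      (α ^ 2 * β + β ^ 2 * γ + γ ^ 2 * α) - 4 * (α * β * γ) ^ 2 +
      3 * (α + β + γ) * (α * β + α * γ + β * γ) * (α * β * γ)) * h2

/-- The `x`-coordinate of the 3-isogeny from `y² + xy = x³ + t³(t + 1)` to
`y² + xy = x³ + t(t + 1)³` whose kernel has abscissa `t`. -/
def isogenyX (t x : F) : F := x * (x ^ 2 + t ^ 2 + t) / (x + t) ^ 2

theorem isogenyX_eq_iff [CharP F 2] {t x X : F} (ht : t ≠ 0) (hX : X ≠ 0) :
    (x ≠ 0 ∧ x + t ≠ 0 ∧ x ^ 2 + t ^ 2 + t ≠ 0) ∧ isogenyX t x = X ↔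
      x ^ 3 + X * x ^ 2 + (t ^ 2 + t) * x + X * t ^ 2 = 0 := by
  have h2 : (2 : F) = 0 := CharTwo.two_eq_zero
  constructor
  · rintro ⟨⟨hx, hxt, hs⟩, rfl⟩
    unfold isogenyX
    field_simp
    linear_combination (x * (x ^ 2 + t ^ 2 + t) * (x ^ 2 + x * t + t ^ 2)) * h2
  · intro h
    have hxt : x + t ≠ 0 := by
      intro h0
      have hx : x = t := CharTwo.add_eq_zero.1 h0
      subst hx
      apply pow_ne_zero 2 ht
      linear_combination h - (x ^ 3 + X * x ^ 2) * h2
    have hmul : x * (x ^ 2 + t ^ 2 + t) = X * (x + t) ^ 2 := by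
      linear_combination h + (-X * x ^ 2 - X * t ^ 2 - X * x * t) * h2
    have hne : x * (x ^ 2 + t ^ 2 + t) ≠ 0 := by
      rw [hmul]; exact mul_ne_zero hX (pow_ne_zero 2 hxt)
    refine ⟨⟨left_ne_zero_of_mul hne, hxt, right_ne_zero_of_mul hne⟩, ?_⟩
    rw [isogenyX, hmul]
    field_simp

variable [Algebra (ZMod 2) F]

/-- The additive character `z ↦ (-1)^{Tr z}`. -/
noncomputable def traceSign (z : F) : ℤ := (-1 : ℤ) ^ (Algebra.trace (ZMod 2) F z).val

theorem traceSign_add (x y : F) : traceSign (x + y) = traceSign x * traceSign y := by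
  unfold traceSign
  rw [map_add]
  generalize Algebra.trace (ZMod 2) F x = u
  generalize Algebra.trace (ZMod 2) F y = v
  revert u v; decide

theorem traceSign_mul_self (x : F) : traceSign x * traceSign x = 1 := by
  rw [traceSign, ← mul_pow]; simp

variable [Fintype F]

theorem traceSign_sq (x : F) : traceSign (x ^ 2) = traceSign x := by
  unfold traceSign
  have := Algebra.trace_eq_of_algEquiv (FiniteField.frobeniusAlgEquivOfAlgebraic (ZMod 2) F) x
  simp only [FiniteField.coe_frobeniusAlgEquivOfAlgebraic, ZMod.card] at this
  rw [this]

theorem traceSign_sq_add_self (g : F) : traceSign (g ^ 2 + g) = 1 := by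
  rw [traceSign_add, traceSign_sq, traceSign_mul_self]

theorem traceSign_eq_of_add_eq [CharP F 2] {x y g : F} (h : x + y = g ^ 2 + g) :
    traceSign x = traceSign y := by
  have hx : x = y + (g ^ 2 + g) := by
    rw [← h, add_comm x, ← add_assoc, CharTwo.add_self_eq_zero, zero_add]
  rw [hx, traceSign_add, traceSign_sq_add_self, mul_one]

/-- Each of the two summands changes by some g² + g, which has trace zero. -/
theorem traceSign_isogenyX [CharP F 2] {t x : F} (hx : x ≠ 0) (hxt : x + t ≠ 0)
    (hs : x ^ 2 + t ^ 2 + t ≠ 0) :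
    traceSign (isogenyX t x + t * (t + 1) ^ 3 / isogenyX t x ^ 2) =
      traceSign (x + t ^ 3 * (t + 1) / x ^ 2) := by
  have h2 : (2 : F) = 0 := CharTwo.two_eq_zero
  have h₁ : isogenyX t x + x = (t / (x + t)) ^ 2 + t / (x + t) := by
    unfold isogenyX
    field_simp
    linear_combination (x ^ 3 + x ^ 2 * t + x * t ^ 2 - t ^ 2) * h2
  have h₂ : t * (t + 1) ^ 3 / isogenyX t x ^ 2 + t ^ 3 * (t + 1) / x ^ 2 =
      (x ^ 2 / (x ^ 2 + t ^ 2 + t)) ^ 2 + x ^ 2 / (x ^ 2 + t ^ 2 + t) := by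
    unfold isogenyX
    field_simp
    linear_combination (t * (t + 1) * ((t + 1) ^ 2 * (2 * x ^ 3 * t + 3 * x ^ 2 * t ^ 2 +
      2 * x * t ^ 3) + t ^ 2 * (x ^ 2 * t ^ 2 + x ^ 2 * t + t ^ 3) + (t ^ 2 + t) * x ^ 4 +
      t ^ 6 + t ^ 5 + t ^ 4) - x ^ 6) * h2
  rw [traceSign_add, traceSign_add, traceSign_eq_of_add_eq h₁, traceSign_eq_of_add_eq h₂]

variable [DecidableEq F] [CharP F 2]

/-- Substitute x = y²/a and use Tr(y²) = Tr(y). -/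
theorem kloostermanSum_eq_sum_traceSign {a : F} (ha : a ≠ 0) :
    kloostermanSum a =
      ∑ x ∈ Finset.univ.filter (fun x : F => x ≠ 0), traceSign (x + a / x ^ 2) := by
  symm
  refine Finset.sum_bij (fun y _ => y ^ 2 / a) ?_ ?_ ?_ ?_
  · intro y hy
    have : y ≠ 0 := by simpa using hy
    simp [this, ha]
  · intro y _ z _ h
    have h' : y ^ 2 = z ^ 2 := by field_simp at h; exact h
    exact frobenius_inj F 2 h'
  · intro x hx
    have hx : x ≠ 0 := by simpa using hx
    refine ⟨sqrtCharTwo (a * x), ?_, ?_⟩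
    · simp only [Finset.mem_filter, Finset.mem_univ, true_and]
      intro h
      have := sqrtCharTwo_sq (a * x)
      rw [h] at this
      simp [ha, hx] at this
    · rw [sqrtCharTwo_sq]; field_simp
  · intro y hy
    have hy : y ≠ 0 := by simpa using hy
    change traceSign (y + a / y ^ 2) = traceSign (a * (y ^ 2 / a) + 1 / (y ^ 2 / a))
    rw [show a * (y ^ 2 / a) + 1 / (y ^ 2 / a) = y ^ 2 + a / y ^ 2 by field_simp,
      traceSign_add, traceSign_add, traceSign_sq]

/-- Dividing the resolvent of the fibre cubic by (Xt)² gives an Artin–Schreier equation with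
constant term X² + t(t+1)³/X² + t², so that term has trace zero. -/
theorem traceSign_eq_of_card_ne_one {t X : F} (ht : t ≠ 0) (hX : X ≠ 0)
    (hN : (Finset.univ.filter fun x : F =>
      x ^ 3 + X * x ^ 2 + (t ^ 2 + t) * x + X * t ^ 2 = 0).card ≠ 1) :
    traceSign (X + t * (t + 1) ^ 3 / X ^ 2) = traceSign t := by
  have h2 : (2 : F) = 0 := CharTwo.two_eq_zero
  have hD : X * (t ^ 2 + t) + X * t ^ 2 = X * t := by linear_combination X * t ^ 2 * h2
  obtain ⟨θ, hθ⟩ := exists_root_quadraticResolvent_of_card_roots_ne_one _ _ _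
    (by rw [hD]; exact mul_ne_zero hX ht) hN
  rw [hD] at hθ
  have h : (X ^ 2 + t * (t + 1) ^ 3 / X ^ 2) + t ^ 2 = (θ / (X * t)) ^ 2 + θ / (X * t) := by
    field_simp
    linear_combination hθ - (θ ^ 2 + X * t * θ) * h2
  have := traceSign_eq_of_add_eq h
  rwa [traceSign_add, traceSign_sq, traceSign_sq, ← traceSign_add] at this

theorem kloostermanSum_cube_mul_succ {t : F} (ht : t ≠ 0) (ht1 : t + 1 ≠ 0) :
    kloostermanSum (t ^ 3 * (t + 1)) = kloostermanSum (t * (t + 1) ^ 3) := by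
  have h2 : (2 : F) = 0 := CharTwo.two_eq_zero
  rw [kloostermanSum_eq_sum_traceSign (mul_ne_zero (pow_ne_zero 3 ht) ht1),
    kloostermanSum_eq_sum_traceSign (mul_ne_zero ht (pow_ne_zero 3 ht1))]
  set U := Finset.univ.filter (fun x : F => x ≠ 0) with hU
  set D := Finset.univ.filter
    (fun x : F => x ≠ 0 ∧ x + t ≠ 0 ∧ x ^ 2 + t ^ 2 + t ≠ 0) with hDdef
  -- The abscissa that `isogenyX` sends to 0; t is its pole.
  set r := sqrtCharTwo (t ^ 2 + t) with hr
  have hrsq : r ^ 2 = t ^ 2 + t := sqrtCharTwo_sq _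
  have hr0 : r ≠ 0 := by
    intro h
    rw [h] at hrsq
    exact mul_ne_zero ht ht1 (by linear_combination -hrsq)
  have hrt : r ≠ t := by
    intro h
    rw [h] at hrsq
    exact ht (by linear_combination -hrsq)
  have hsr (x : F) : x ^ 2 + t ^ 2 + t = 0 ↔ x = r := by
    rw [add_assoc, ← hrsq, CharTwo.add_eq_zero]
    exact (frobenius_inj F 2).eq_iff
  have hDU : D = (U.erase t).erase r := by
    ext x
    simp only [hDdef, hU, Finset.mem_filter, Finset.mem_univ, true_and, Finset.mem_erase, ne_eq,
      hsr, CharTwo.add_eq_zero]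
    tauto
  have htU : t ∈ U := by simp [hU, ht]
  have hrU : r ∈ U.erase t := by simp [hU, hr0, hrt]
  have hcard : (D.card : ℤ) + 2 = U.card := by
    rw [hDU, ← Finset.card_erase_add_one htU, ← Finset.card_erase_add_one hrU]
    push_cast; ring
  have hsum : ∑ x ∈ U, traceSign (x + t ^ 3 * (t + 1) / x ^ 2) =
      (∑ x ∈ D, traceSign (x + t ^ 3 * (t + 1) / x ^ 2)) + 2 * traceSign t := by
    rw [hDU, ← Finset.sum_erase_add _ _ htU, ← Finset.sum_erase_add _ _ hrU]
    have e₁ : traceSign (t + t ^ 3 * (t + 1) / t ^ 2) = traceSign t := by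
      rw [show t + t ^ 3 * (t + 1) / t ^ 2 = t ^ 2 by field_simp; linear_combination h2,
        traceSign_sq]
    have e₂ : traceSign (r + t ^ 3 * (t + 1) / r ^ 2) = traceSign t := by
      have : t ^ 3 * (t + 1) / r ^ 2 = t ^ 2 := by
        rw [hrsq, show t ^ 2 + t = t * (t + 1) by ring]; field_simp
      rw [this, traceSign_add, ← traceSign_sq r, hrsq, ← traceSign_add,
        show t ^ 2 + t + t ^ 2 = t by linear_combination t ^ 2 * h2]
    rw [e₁, e₂]; ring
  have hmaps : ∀ x ∈ D, isogenyX t x ∈ U := by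
    intro x hx
    simp only [hDdef, Finset.mem_filter, Finset.mem_univ, true_and] at hx
    simp [hU, isogenyX, hx]
  have hfib : ∑ x ∈ D, traceSign (x + t ^ 3 * (t + 1) / x ^ 2) =
      ∑ X ∈ U, ((D.filter fun x => isogenyX t x = X).card : ℤ) *
        traceSign (X + t * (t + 1) ^ 3 / X ^ 2) := by
    rw [← Finset.sum_fiberwise_of_maps_to hmaps]
    refine Finset.sum_congr rfl fun X _ => ?_
    rw [← nsmul_eq_mul, ← Finset.sum_const]
    refine Finset.sum_congr rfl fun x hx => ?_
    simp only [hDdef, Finset.mem_filter, Finset.mem_univ, true_and] at hx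
    rw [← hx.2, traceSign_isogenyX hx.1.1 hx.1.2.1 hx.1.2.2]
  have hcardfib : (D.card : ℤ) = ∑ X ∈ U, ((D.filter fun x => isogenyX t x = X).card : ℤ) := by
    exact_mod_cast Finset.card_eq_sum_card_fiberwise hmaps
  have hkey : ∑ X ∈ U, (((D.filter fun x => isogenyX t x = X).card : ℤ) - 1) *
      (traceSign (X + t * (t + 1) ^ 3 / X ^ 2) - traceSign t) = 0 := by
    refine Finset.sum_eq_zero fun X hX => ?_
    have hX : X ≠ 0 := by simpa [hU] using hX
    by_cases hN : (D.filter fun x => isogenyX t x = X).card = 1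
    · rw [hN]; simp
    · rw [traceSign_eq_of_card_ne_one ht hX, sub_self, mul_zero]
      rw [hDdef, Finset.filter_filter] at hN
      simpa only [isogenyX_eq_iff ht hX] using hN
  simp only [sub_mul, mul_sub, one_mul, Finset.sum_sub_distrib, ← Finset.sum_mul,
    Finset.sum_const, nsmul_eq_mul] at hkey
  rw [← hfib, ← hcardfib] at hkey
  rw [hsum]
  linear_combination hkey + traceSign t * hcard

end

theorem theorem2 (m : ℕ) (hm : 0 < m) {F : Type*} [Field F] [Fintype F] [DecidableEq F]
    [CharP F 2] [Algebra (ZMod 2) F] (hF : Fintype.card F = 2 ^ m)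
    (b c k₁ k₂ : F) (hk₁ : k₁ = b ^ 2 + c + 1) (hk₂ : k₂ = b ^ 2 + b + c + sqrtCharTwo c)
    (hk : k₁ * k₂ ≠ 0) :
    kloostermanSum (k₁ * k₂) = kloostermanSum (k₁ * k₂ + k₂) := by
  have h2 : (2 : F) = 0 := CharTwo.two_eq_zero
  have hs : sqrtCharTwo c ^ 2 = c := sqrtCharTwo_sq c
  generalize sqrtCharTwo c = s at hk₂ hs
  obtain ⟨t, rfl⟩ : ∃ t, b = t + s := ⟨b - s, by ring⟩
  have h₁ : k₁ = (t + 1) ^ 2 := by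
    rw [hk₁, ← hs]; linear_combination (t * s + s ^ 2 - t) * h2
  have h₂ : k₂ = t * (t + 1) := by
    rw [hk₂, ← hs]; linear_combination (t * s + s ^ 2 + s) * h2
  have ht : t ≠ 0 := by rintro rfl; simp [h₂] at hk
  have ht1 : t + 1 ≠ 0 := by intro h; simp [h₁, h] at hk
  rw [show k₁ * k₂ = t * (t + 1) ^ 3 by rw [h₁, h₂]; ring,
    show t * (t + 1) ^ 3 + k₂ = t ^ 3 * (t + 1) by
      rw [h₂]; linear_combination (t ^ 3 + 2 * t ^ 2 + t) * h2]
  exact (kloostermanSum_cube_mul_succ ht ht1).symm
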